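/- A topological space $X$ is called \emph{submetrizable} if its topology contains a (coarser) metrizable topology on the same set. For a family $\mathcal G$ of subsets of a space $Y$ and $A\subseteq Y$ put $\operatorname{St}(A,\mathcal G)=\bigcup\{U\in\mathcal G : U\cap A\neq\emptyset\}$ and $\operatorname{St}(x,\mathcal G)=\operatorname{St}(\{x\},\mathcal G)$. A space $Y$ is called an \emph{M-space} if there is a sequence $(\mathcal G_n)_{n\in\mathbb N}$ of open covers of $Y$ such that (i) $\mathcal G_{n+1}$ star-refines $\mathcal G_n$ for every $n$, i.e. for each $U\in\mathcal G_{n+1}$ there is $V\in\mathcal G_n$ with $\operatorname{St}(U,\mathcal G_{n+1})\subseteq V$; and (ii) whenever $x\in Y$ and $x_n\in\operatorname{St}(x,\mathcal G_n)$ for all $n$, the sequence $(x_n)$ has a cluster point in $Y$. \textbf{Theorem.} Let $X$ be a submetrizable space, let $Y$ be a Hausdorff M-space, and let $f\colon X\to Y$ be a continuous closed surjection (that is, $f$ maps closed subsets of $X$ onto closed subsets of $Y$). Then $Y$ is metrizable. -/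

import Mathlib

open Filter Topology

/-- A topological space is submetrizable if it has a weaker (coarser) metrizable topology.
In Mathlib's order on topologies, `τ ≤ σ` means that every `σ`-open set is `τ`-open. -/
def IsSubmetrizable (X : Type*) [τ : TopologicalSpace X] : Prop :=
  ∃ σ : TopologicalSpace X, τ ≤ σ ∧ @TopologicalSpace.MetrizableSpace X σ

/-- The star of a set `A` with respect to a family `𝒢` of sets: the union of all members of `𝒢`
that meet `A`. -/
def coverStar {X : Type*} (A : Set X) (𝒢 : Set (Set X)) : Set X :=
  ⋃₀ {U | U ∈ 𝒢 ∧ (U ∩ A).Nonempty}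

/-- `𝒢` is an open cover of the space. -/
def IsOpenCoverFamily {X : Type*} [TopologicalSpace X] (𝒢 : Set (Set X)) : Prop :=
  (∀ U ∈ 𝒢, IsOpen U) ∧ ⋃₀ 𝒢 = Set.univ

/-- `ℋ` star-refines `𝒢`: the star of each member of `ℋ` with respect to `ℋ` is contained in a
member of `𝒢`. -/
def StarRefines {X : Type*} (ℋ 𝒢 : Set (Set X)) : Prop :=
  ∀ U ∈ ℋ, ∃ V ∈ 𝒢, coverStar U ℋ ⊆ V

/-- A topological space is an M-space (Morita) if it has a sequence of open covers `𝒢 n`, each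
star-refined by the next, such that every sequence `u` with `u n` in the star of a fixed point `x`
with respect to `𝒢 n`, for all `n`, has a cluster point. -/
def IsMSpace (X : Type*) [TopologicalSpace X] : Prop :=
  ∃ 𝒢 : ℕ → Set (Set X),
    (∀ n, IsOpenCoverFamily (𝒢 n)) ∧
    (∀ n, StarRefines (𝒢 (n + 1)) (𝒢 n)) ∧
    ∀ (x : X) (u : ℕ → X), (∀ n, u n ∈ coverStar {x} (𝒢 n)) → ∃ p : X, MapClusterPt p atTop u

universe u v

/-! The M-structure gives a continuous map `g` from `Y` to a metric space along which sequences with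
convergent image cluster. Pairing `g ∘ f` with a continuous injection of `X` into a metric space
gives an injective `e`. Let `A` contain one point of each fiber of `f`. Sequences in `A` with
convergent `e`-image converge in `X`: their `f`-images cluster, and closedness of `f` lifts this to
`A`. Hence `f ∘ e⁻¹` is defined, continuous and closed on `closure (e '' A)`, so `Y` is a closed
image of a metric space (`IsClosedMap.exists_metric_domain`).

Then `g` has compact fibers, `Y` is paracompact, and partitions of unity subordinate to
point-separating covers turn `g` into an injective map to a metrizable space. Clustering makes that
map an embedding. -/

/-- Every sequence whose image under `g` converges has a cluster point. -/
def ClustersAlong {Y Z : Type*} [TopologicalSpace Y] [TopologicalSpace Z] (g : Y → Z) : Prop :=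
  ∀ (u : ℕ → Y) (z : Z), Tendsto (g ∘ u) atTop (𝓝 z) → ∃ p, MapClusterPt p atTop u

/-! ### From M-spaces to maps into metric spaces -/

theorem ClustersAlong.exists_metricSpace {Y : Type u} {P : Type v} [TopologicalSpace Y]
    [PseudoMetricSpace P] {g : Y → P} (hc : Continuous g) (hg : ClustersAlong g) :
    ∃ (Z : Type v) (_ : MetricSpace Z) (g : Y → Z),
      Continuous g ∧ ClustersAlong g := by
  refine ⟨SeparationQuotient P, inferInstance, SeparationQuotient.mk ∘ g,
    SeparationQuotient.continuous_mk.comp hc, ?_⟩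
  intro u z hz
  obtain ⟨x, rfl⟩ := SeparationQuotient.surjective_mk z
  exact hg u x (SeparationQuotient.isInducing_mk.tendsto_nhds_iff.2 hz)

/-- An M-space maps onto a metric space in such a way that sequences with convergent image have
cluster points. -/
theorem IsMSpace.exists_clustersAlong {Y : Type u} [TopologicalSpace Y] (hY : IsMSpace Y) :
    ∃ (Z : Type u) (_ : MetricSpace Z) (g : Y → Z),
      Continuous g ∧ ClustersAlong g := by
  obtain ⟨𝒢, hcov, hstar, hclust⟩ := hY
  let E : ℕ → Set (Y × Y) := fun n => {p | ∃ U ∈ 𝒢 n, p.1 ∈ U ∧ p.2 ∈ U}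
  have hcomp : ∀ n x y z, (x, y) ∈ E (n + 1) → (y, z) ∈ E (n + 1) → (x, z) ∈ E n := by
    rintro n x y z ⟨U, hU, hx, hy⟩ ⟨U', hU', hy', hz⟩
    obtain ⟨V, hV, hUV⟩ := hstar n U hU
    exact ⟨V, hV, hUV ⟨U, ⟨hU, x, hx, hx⟩, hx⟩, hUV ⟨U', ⟨hU', y, hy', hy⟩, hz⟩⟩
  have hrefl : ∀ n x, (x, x) ∈ E n := by
    intro n x
    obtain ⟨U, hU, hx⟩ := Set.mem_sUnion.1 ((hcov n).2.ge (Set.mem_univ x))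
    exact ⟨U, hU, hx, hx⟩
  have hanti : Antitone E := antitone_nat_of_succ_le fun n ⟨x, y⟩ h =>
    hcomp n x x y (hrefl _ _) h
  have hb : HasBasis (⨅ n, 𝓟 (E n)) (fun _ => True) E :=
    hasBasis_iInf_principal hanti.directed_ge
  let c : UniformSpace.Core Y :=
    { uniformity := ⨅ n, 𝓟 (E n)
      refl := hb.ge_iff.2 fun n _ => by
        rintro ⟨x, y⟩ h
        obtain rfl : x = y := h
        exact hrefl n x
      symm := (hb.tendsto_iff hb).2 fun n _ =>
        ⟨n, trivial, fun p ⟨U, hU, h1, h2⟩ => ⟨U, hU, h2, h1⟩⟩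
      comp := by
        refine hb.ge_iff.2 fun n _ => ?_
        refine mem_of_superset (mem_lift' (hb.mem_of_mem (i := n + 1) trivial)) ?_
        rintro ⟨x, z⟩ ⟨y, h1, h2⟩
        exact hcomp n x y z h1 h2 }
  have hnhds : ∀ x, HasBasis (@nhds Y c.toTopologicalSpace x) (fun _ => True)
      (fun n => Prod.mk x ⁻¹' E n) := by
    intro x
    rw [c.nhds_toTopologicalSpace x]
    exact hb.comap _
  have hle : ‹TopologicalSpace Y› ≤ c.toTopologicalSpace := by
    refine (le_iff_nhds _ _).2 fun x => (hnhds x).ge_iff.2 fun n _ => ?_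
    obtain ⟨U, hU, hx, -⟩ := hrefl n x
    exact mem_of_superset (((hcov n).1 U hU).mem_nhds hx) fun y hy => ⟨U, hU, hx, hy⟩
  let uY : UniformSpace Y := UniformSpace.ofCore c
  have hcg : IsCountablyGenerated (@uniformity Y uY) :=
    HasCountableBasis.isCountablyGenerated ⟨hb, Set.to_countable _⟩
  let mY : PseudoMetricSpace Y := @UniformSpace.pseudoMetricSpace Y uY hcg
  refine @ClustersAlong.exists_metricSpace Y Y _ mY id (continuous_id_of_le hle)
    fun u x hx => ?_
  -- The M-space condition needs the `n`-th term in the `n`-th star, so a subsequence is matched to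
  -- the covers.
  have hev : ∀ n, ∃ᶠ k in atTop, (x, u k) ∈ E n := fun n =>
    (Tendsto.eventually hx ((hnhds x).mem_of_mem (i := n) trivial)).frequently
  obtain ⟨φ, hφ, hφE⟩ := extraction_forall_of_frequently hev
  obtain ⟨p, hp⟩ := hclust x (u ∘ φ) fun n => by
    obtain ⟨U, hU, h1, h2⟩ := hφE n
    exact ⟨U, ⟨hU, x, h1, rfl⟩, h2⟩
  exact ⟨p, hp.of_comp hφ.tendsto_atTop⟩

/-! ### Lifting cluster points through closed maps -/

section ClusterPoints

variable {X Y : Type*} [TopologicalSpace X] [TopologicalSpace Y]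

theorem MapClusterPt.eq_of_tendsto [T2Space X] {u : ℕ → X} {x y : X}
    (hx : MapClusterPt x atTop u) (hy : Tendsto u atTop (𝓝 y)) : x = y := by
  by_contra hne
  obtain ⟨U, V, hU, hV, hxU, hyV, hUV⟩ := t2_separation hne
  obtain ⟨n, hnU, hnV⟩ := ((mapClusterPt_iff_frequently.1 hx U (hU.mem_nhds hxU)).and_eventually
    (hy.eventually (hV.mem_nhds hyV))).exists
  exact Set.disjoint_left.1 hUV hnU hnV

/-- If every subsequence of `u` has a cluster point and `x` is the only possible one, then `u`
converges to `x`. -/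
theorem tendsto_of_mapClusterPt_subseq {u : ℕ → X} {x : X}
    (h : ∀ φ : ℕ → ℕ, StrictMono φ → MapClusterPt x atTop (u ∘ φ)) :
    Tendsto u atTop (𝓝 x) := by
  intro U hU
  by_contra hnot
  obtain ⟨φ, hφ, hφU⟩ := extraction_of_frequently_atTop (P := fun n => u n ∉ U)
    (not_eventually.1 hnot)
  obtain ⟨n, hn⟩ := ((mapClusterPt_iff_frequently.1 (h φ hφ)) U hU).exists
  exact hφU n hn

/-- A cluster point of the image of a sequence under a closed map that takes each value only
finitely often along the sequence forces the sequence to cluster. -/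
theorem IsClosedMap.exists_mapClusterPt [T1Space X] {f : X → Y} (hf : IsClosedMap f)
    {s : ℕ → X} {p : Y} (hp : MapClusterPt p atTop (f ∘ s)) (hfin : ∀ᶠ n in atTop, f (s n) ≠ p) :
    ∃ x, MapClusterPt x atTop s := by
  by_contra! hno
  obtain ⟨N, hN⟩ := eventually_atTop.1 hfin
  -- Dropping `N` terms leaves a closed set whose image misses `p`, although `p` is a cluster point
  -- of that image.
  have hlf : LocallyFinite fun n => ({s (n + N)} : Set X) := by
    intro x
    have := hno x
    rw [mapClusterPt_iff_frequently] at this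
    push Not at this
    obtain ⟨t, ht, hev⟩ := this
    obtain ⟨K, hK⟩ := eventually_atTop.1 hev
    refine ⟨t, ht, (Set.finite_lt_nat K).subset ?_⟩
    rintro n ⟨y, hy, hyt⟩
    obtain rfl : y = s (n + N) := hy
    by_contra hn
    exact hK (n + N) (by simp only [Set.mem_ofPred_eq] at hn; omega) hyt
  have hcl := hf _ (hlf.isClosed_iUnion fun n => isClosed_singleton)
  have hpn : p ∉ f '' ⋃ n, {s (n + N)} := by
    rintro ⟨x, hx, rfl⟩
    obtain ⟨n, rfl⟩ := Set.mem_iUnion.1 hx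
    exact hN (n + N) (by omega) rfl
  obtain ⟨n, hn, hnN⟩ := ((mapClusterPt_iff_frequently.1 hp _
    (hcl.isOpen_compl.mem_nhds hpn)).and_eventually (eventually_ge_atTop N)).exists
  refine hn ⟨s n, Set.mem_iUnion.2 ⟨n - N, ?_⟩, rfl⟩
  rw [Nat.sub_add_cancel hnN]
  rfl

theorem IsClosedMap.exists_mapClusterPt_of_injOn [T1Space X] {f : X → Y} (hf : IsClosedMap f)
    {A : Set X} (hA : Set.InjOn f A) {s : ℕ → X} (hs : ∀ n, s n ∈ A) {p : Y}
    (hp : MapClusterPt p atTop (f ∘ s)) : ∃ x, MapClusterPt x atTop s := by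
  by_cases h : ∃ᶠ n in atTop, f (s n) = p
  · obtain ⟨m, hm⟩ := h.exists
    refine ⟨s m, mapClusterPt_iff_frequently.2 fun U hU => h.mono fun n hn => ?_⟩
    rw [hA (hs n) (hs m) (hn.trans hm.symm)]
    exact mem_of_mem_nhds hU
  · exact hf.exists_mapClusterPt hp (not_frequently.1 h)

end ClusterPoints

/-! ### Replacing the domain by a metric space -/

theorem IsSubmetrizable.exists_injective {X : Type u} [TopologicalSpace X]
    (hX : IsSubmetrizable X) :
    ∃ (M : Type u) (_ : MetricSpace M) (i : X → M), Continuous i ∧ Function.Injective i := by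
  obtain ⟨σ, hσ, hm⟩ := hX
  exact ⟨X, @TopologicalSpace.metrizableSpaceMetric X σ hm, id, continuous_id_of_le hσ,
    Function.injective_id⟩

/-- A closed map defined on a space with a coarser metrizable topology can be replaced by a
closed map defined on a metric space, if the codomain has sufficiently many cluster points. -/
theorem IsClosedMap.exists_metric_domain {X M Y Z : Type*} [TopologicalSpace X] [T1Space X]
    [MetricSpace M] [TopologicalSpace Y] [T2Space Y] [TopologicalSpace Z]
    {f : X → Y} (hf : Continuous f) (hcl : IsClosedMap f) (hsurj : Function.Surjective f)
    {g : Y → Z} (hg : ClustersAlong g)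
    {e : X → M} (he : Continuous e) (hinj : Function.Injective e)
    {π : M → Z} (hπ : Continuous π) (hπe : ∀ x, π (e x) = g (f x)) :
    ∃ (T : Set M) (φ : T → Y), Continuous φ ∧ IsClosedMap φ ∧ Function.Surjective φ := by
  obtain ⟨r, hr⟩ := hsurj.hasRightInverse
  set A : Set X := Set.range r with hAdef
  have hA : Set.InjOn f A := by
    rintro _ ⟨a, rfl⟩ _ ⟨b, rfl⟩ h
    rw [hr, hr] at h
    rw [h]
  have hfclust : ∀ (s : ℕ → X) (m : M), Tendsto (e ∘ s) atTop (𝓝 m) →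
      ∃ p, MapClusterPt p atTop (f ∘ s) := by
    intro s m hs
    refine hg _ (π m) ?_
    have := (hπ.tendsto m).comp hs
    exact this.congr fun n => hπe _
  have hlim : ∀ (s : ℕ → X) (m : M) (x : X), Tendsto (e ∘ s) atTop (𝓝 m) →
      MapClusterPt x atTop s → e x = m := by
    intro s m x hs hx
    have h1 : MapClusterPt (e x) atTop (e ∘ s) := hx.continuousAt_comp he.continuousAt
    exact h1.eq_of_tendsto hs
  have hconv : ∀ (a : ℕ → X) (m : M), (∀ n, a n ∈ A) → Tendsto (e ∘ a) atTop (𝓝 m) →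
      ∃ x, e x = m ∧ Tendsto a atTop (𝓝 x) := by
    intro a m ha hm
    have key : ∀ φ : ℕ → ℕ, StrictMono φ → ∃ x, e x = m ∧ MapClusterPt x atTop (a ∘ φ) := by
      intro φ hφ
      have hφm : Tendsto (e ∘ (a ∘ φ)) atTop (𝓝 m) := hm.comp hφ.tendsto_atTop
      obtain ⟨p, hp⟩ := hfclust _ m hφm
      obtain ⟨x, hx⟩ := hcl.exists_mapClusterPt_of_injOn hA (fun n => ha (φ n)) hp
      exact ⟨x, hlim _ m x hφm hx, hx⟩
    obtain ⟨x, hxm, -⟩ := key id strictMono_id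
    refine ⟨x, hxm, tendsto_of_mapClusterPt_subseq fun φ hφ => ?_⟩
    obtain ⟨x', hx', hc⟩ := key φ hφ
    rwa [hinj (hxm.trans hx'.symm)]
  have hnear : ∀ (x : X) (U : Set Y), U ∈ 𝓝 (f x) →
      ∃ N, IsOpen N ∧ e x ∈ N ∧ ∀ a ∈ A, e a ∈ N → f a ∈ U := by
    intro x U hU
    have : ∀ᶠ m in 𝓝 (e x), ∀ a ∈ A, e a = m → f a ∈ U := by
      by_contra hnot
      obtain ⟨m, hm, hmU⟩ := exists_seq_forall_of_frequently (not_eventually.1 hnot)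
      push Not at hmU
      choose a haA ham haU using hmU
      have hea : e ∘ a = m := funext ham
      obtain ⟨x', hx', hax⟩ := hconv a (e x) haA (hea ▸ hm)
      obtain rfl := hinj hx'
      obtain ⟨n, hn⟩ := (((hf.tendsto x').comp hax).eventually hU).exists
      exact haU n hn
    obtain ⟨N, hN, hNo, hx⟩ := eventually_nhds_iff.1 this
    exact ⟨N, hNo, hx, fun a ha hea => hN _ hea a ha rfl⟩
  have hT : ∀ t : closure (e '' A), ∃ x ∈ closure A, e x = t := by
    rintro ⟨t, ht⟩
    obtain ⟨m, hm, hmt⟩ := mem_closure_iff_seq_limit.1 ht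
    choose a haA ham using hm
    obtain rfl : e ∘ a = m := funext ham
    obtain ⟨x, hx, hax⟩ := hconv a t haA hmt
    exact ⟨x, mem_closure_of_tendsto hax (Eventually.of_forall haA), hx⟩
  choose ψ hψA hψ using hT
  refine ⟨closure (e '' A), f ∘ ψ, ?_, ?_, ?_⟩
  · rw [continuous_iff_seqContinuous]
    intro t₀ t ht
    have hx : Tendsto (fun n => e (ψ (t₀ n))) atTop (𝓝 (e (ψ t))) := by
      simp only [hψ]
      exact (continuous_subtype_val.tendsto t).comp ht
    refine tendsto_of_mapClusterPt_subseq fun φ hφ => ?_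
    have hxφ : Tendsto (e ∘ (fun n => ψ (t₀ (φ n)))) atTop (𝓝 (e (ψ t))) :=
      hx.comp hφ.tendsto_atTop
    obtain ⟨p, hp⟩ := hfclust _ _ hxφ
    change MapClusterPt (f (ψ t)) atTop (f ∘ fun n => ψ (t₀ (φ n)))
    -- The points `ψ (t₀ (φ n))` lie only in `closure A`, where `f` need not be injective. If `p` is
    -- a frequent value, a nearby point of `A` has its value in both `U` and `V`.
    by_cases hfreq : ∃ᶠ n in atTop, f (ψ (t₀ (φ n))) = p
    · suffices p = f (ψ t) from this ▸ hp
      by_contra hne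
      obtain ⟨U, V, hU, hV, hpU, htV, hUV⟩ := t2_separation hne
      obtain ⟨N, hNo, htN, hN⟩ := hnear (ψ t) V (hV.mem_nhds htV)
      obtain ⟨n, hnp, hnN⟩ :=
        (hfreq.and_eventually (hxφ.eventually (hNo.mem_nhds htN))).exists
      obtain ⟨a, ⟨haN, haU⟩, haA⟩ := mem_closure_iff.1 (hψA (t₀ (φ n))) (e ⁻¹' N ∩ f ⁻¹' U)
        ((hNo.preimage he).inter (hU.preimage hf)) ⟨hnN, by rw [Set.mem_preimage, hnp]; exact hpU⟩
      exact Set.disjoint_left.1 hUV haU (hN a haA haN)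
    · obtain ⟨x, hx⟩ := hcl.exists_mapClusterPt hp (not_frequently.1 hfreq)
      obtain rfl := hinj (hlim _ _ x hxφ hx)
      exact MapClusterPt.continuousAt_comp hf.continuousAt hx
  · intro F hF
    have hF' : IsClosed (Subtype.val '' F) := isClosed_closure.isClosedMap_subtype_val F hF
    -- Injectivity of `e` identifies the image of `F` with `f '' (e ⁻¹' F)`.
    convert hcl _ (hF'.preimage he) using 1
    ext y
    constructor
    · rintro ⟨t, ht, rfl⟩
      exact ⟨ψ t, ⟨t, ht, (hψ t).symm⟩, rfl⟩
    · rintro ⟨x, ⟨t, ht, htx⟩, rfl⟩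
      refine ⟨t, ht, ?_⟩
      rw [Function.comp_apply, hinj ((hψ t).trans htx)]
  · intro y
    refine ⟨⟨e (r y), subset_closure ⟨r y, ⟨y, rfl⟩, rfl⟩⟩, ?_⟩
    rw [Function.comp_apply, hinj (hψ ⟨e (r y), _⟩), hr]

/-! ### Compact fibers and paracompactness -/

/-- A sequence avoiding a neighborhood of `y` while its image tends to `h y` would cluster, and by
injectivity only at `y`. -/
theorem ClustersAlong.isEmbedding {Y E : Type*} [TopologicalSpace Y] [TopologicalSpace E]
    [FirstCountableTopology E] [T2Space E] {h : Y → E} (hc : ClustersAlong h)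
    (hcont : Continuous h) (hinj : Function.Injective h) : IsEmbedding h := by
  refine ⟨isInducing_iff_nhds.2 fun y => le_antisymm (hcont.tendsto y).le_comap ?_, hinj⟩
  intro U hU
  by_contra hnot
  have hfreq : ∃ᶠ y' in comap h (𝓝 (h y)), y' ∉ U := not_eventually.1 hnot
  obtain ⟨u, hu, huU⟩ := exists_seq_forall_of_frequently hfreq
  have hhu : Tendsto (h ∘ u) atTop (𝓝 (h y)) := tendsto_comap_iff.1 hu
  obtain ⟨p, hp⟩ := hc u _ hhu
  obtain rfl := hinj ((hp.continuousAt_comp hcont.continuousAt).eq_of_tendsto hhu)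
  obtain ⟨n, hn⟩ := (mapClusterPt_iff_frequently.1 hp U hU).exists
  exact huU n hn

theorem ClustersAlong.eventually_preimage_subset {Y Z : Type*} [TopologicalSpace Y]
    [TopologicalSpace Z] [FirstCountableTopology Z] [T2Space Z] {g : Y → Z}
    (hg : ClustersAlong g) (hcont : Continuous g) {z : Z} {U : Set Y} (hU : IsOpen U)
    (hzU : g ⁻¹' {z} ⊆ U) : ∀ᶠ w in 𝓝 z, g ⁻¹' {w} ⊆ U := by
  by_contra hnot
  obtain ⟨w, hw, hwU⟩ := exists_seq_forall_of_frequently (not_eventually.1 hnot)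
  simp only [Set.not_subset] at hwU
  choose u huw huU using hwU
  obtain rfl : g ∘ u = w := funext huw
  obtain ⟨p, hp⟩ := hg u z hw
  have hpz : g p = z := (hp.continuousAt_comp hcont.continuousAt).eq_of_tendsto hw
  obtain ⟨n, hn⟩ := (mapClusterPt_iff_frequently.1 hp U (hU.mem_nhds (hzU hpz))).exists
  exact huU n hn

/-- A closed image of a metric space has compact fibers along a map with cluster points. -/
theorem ClustersAlong.isCompact_fiber {T Y Z : Type*} [MetricSpace T] [TopologicalSpace Y]
    [TopologicalSpace Z] [T1Space Z] {φ : T → Y} (hφ : Continuous φ) (hcl : IsClosedMap φ)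
    (hsurj : Function.Surjective φ) {g : Y → Z} (hg : ClustersAlong g) (hcont : Continuous g)
    (z : Z) : IsCompact (g ⁻¹' {z}) := by
  obtain ⟨r, hr⟩ := hsurj.hasRightInverse
  set S : Set T := r '' (g ⁻¹' {z}) with hS
  have hinj : Set.InjOn φ S := by
    rintro _ ⟨a, -, rfl⟩ _ ⟨b, -, rfl⟩ h
    rw [hr, hr] at h
    rw [h]
  have hcomp : IsCompact (closure S) := by
    refine IsSeqCompact.isCompact fun w hw => ?_
    have : ∀ n : ℕ, ∃ a ∈ S, dist (w n) a < 1 / ((n : ℝ) + 1) := fun n =>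
      Metric.mem_closure_iff.1 (hw n) _ Nat.one_div_pos_of_nat
    choose a haS haw using this
    have hga : g ∘ (φ ∘ a) = fun _ => z := by
      funext n
      obtain ⟨y, hy, hya⟩ := haS n
      rw [Function.comp_apply, Function.comp_apply, ← hya, hr]
      exact hy
    obtain ⟨p, hp⟩ := hg (φ ∘ a) z (by rw [hga]; exact tendsto_const_nhds)
    obtain ⟨x, hx⟩ := hcl.exists_mapClusterPt_of_injOn hinj haS hp
    obtain ⟨ψ, hψ, hψx⟩ := hx.tendsto_subseq
    have hdist : Tendsto (fun n => dist (a (ψ n)) (w (ψ n))) atTop (𝓝 0) :=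
      squeeze_zero (fun _ => dist_nonneg) (fun n => by rw [dist_comm]; exact (haw (ψ n)).le)
        (tendsto_one_div_add_atTop_nhds_zero_nat.comp hψ.tendsto_atTop)
    exact ⟨x, mem_closure_of_tendsto hψx (Eventually.of_forall fun n => haS _), ψ, hψ,
      hψx.congr_dist hdist⟩
  refine (hcomp.image hφ).of_isClosed_subset (isClosed_singleton.preimage hcont) fun y hy => ?_
  exact ⟨r y, subset_closure ⟨y, hy, rfl⟩, hr y⟩

/-- A space with a continuous map to a metric space that has compact fibers and along which
sequences have cluster points is paracompact. -/
theorem ClustersAlong.paracompactSpace {Y Z : Type u} [TopologicalSpace Y] [MetricSpace Z]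
    {g : Y → Z} (hg : ClustersAlong g) (hcont : Continuous g)
    (hfib : ∀ z, IsCompact (g ⁻¹' {z})) : ParacompactSpace Y := by
  refine ⟨fun α s hs hcov => ?_⟩
  choose I hI using fun z => (hfib z).elim_finite_subcover s hs
    (hcov ▸ Set.subset_univ _)
  have hO : ∀ z, ∃ O, IsOpen O ∧ z ∈ O ∧ g ⁻¹' O ⊆ ⋃ i ∈ I z, s i := by
    intro z
    obtain ⟨O, hO, hOo, hz⟩ := eventually_nhds_iff.1 <| hg.eventually_preimage_subset hcont
      (isOpen_biUnion fun i _ => hs i) (hI z)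
    exact ⟨O, hOo, hz, fun y hy => hO _ hy rfl⟩
  choose O hOo hzO hOs using hO
  obtain ⟨v, hvo, hvcov, hvfin, hvO⟩ := precise_refinement O hOo
    (Set.eq_univ_of_forall fun z => Set.mem_iUnion.2 ⟨z, hzO z⟩)
  refine ⟨Z × α, fun b => ⋃ _ : b.2 ∈ I b.1, g ⁻¹' v b.1 ∩ s b.2, ?_, ?_, ?_, ?_⟩
  · exact fun b => isOpen_iUnion fun _ => ((hvo _).preimage hcont).inter (hs _)
  · refine Set.eq_univ_of_forall fun y => ?_
    obtain ⟨z, hz⟩ := Set.mem_iUnion.1 (hvcov.ge (Set.mem_univ (g y)))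
    obtain ⟨i, hi, hy⟩ := Set.mem_iUnion₂.1 (hOs z (hvO z hz))
    exact Set.mem_iUnion.2 ⟨(z, i), Set.mem_iUnion.2 ⟨hi, hz, hy⟩⟩
  · intro y
    obtain ⟨N, hN, hfin⟩ := hvfin (g y)
    refine ⟨g ⁻¹' N, hcont.continuousAt hN,
      (hfin.biUnion fun z _ => ((I z).finite_toSet.image (Prod.mk z))).subset ?_⟩
    rintro ⟨z, i⟩ ⟨y', hy', hyN⟩
    obtain ⟨hi, hyv, -⟩ := Set.mem_iUnion.1 hy'
    exact Set.mem_biUnion (show z ∈ _ from ⟨g y', hyv, hyN⟩) ⟨i, hi, rfl⟩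
  · exact fun b => ⟨b.2, Set.iUnion_subset fun _ => Set.inter_subset_right⟩

/-! ### Separating points and metrization -/

/-- The functions of a partition of unity, viewed as one map to a function space, are jointly
continuous for the topology of uniform convergence. -/
theorem PartitionOfUnity.continuous_uniformFun {ι Y : Type*} [TopologicalSpace Y]
    (ρ : PartitionOfUnity ι Y) :
    Continuous fun y => UniformFun.ofFun fun i => ρ i y := by
  refine continuous_iff_continuousAt.2 fun y => ?_
  refine UniformFun.tendsto_iff_tendstoUniformly.2 (Metric.tendstoUniformly_iff.2 fun ε hε => ?_)
  obtain ⟨t, ht, hfin⟩ := ρ.locallyFinite y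
  have h1 : ∀ᶠ x in 𝓝 y, ∀ i ∈ {i | (Function.support (ρ i) ∩ t).Nonempty},
      dist (ρ i y) (ρ i x) < ε := by
    refine (eventually_all_finite hfin).2 fun i _ => ?_
    have := (Metric.tendsto_nhds.1 ((ρ i).continuous.tendsto y)) ε hε
    simpa only [dist_comm] using this
  filter_upwards [h1, ht] with x hx hxt i
  change dist (ρ i y) (ρ i x) < ε
  by_cases hi : (Function.support (ρ i) ∩ t).Nonempty
  · exact hx i hi
  · have h0 : ∀ w ∈ t, ρ i w = 0 := fun w hw => by
      by_contra hne
      exact hi ⟨w, hne, hw⟩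
    rw [h0 y (mem_of_mem_nhds ht), h0 x hxt, dist_self]
    exact hε

/-- An open cover of a paracompact Hausdorff space is refined by the fibers of a continuous map to
a metrizable function space. -/
theorem exists_continuous_uniformFun_fiber_subset {ι Y : Type*} [TopologicalSpace Y] [T2Space Y]
    [ParacompactSpace Y] (V : ι → Set Y) (hV : ∀ i, IsOpen (V i)) (hcov : ⋃ i, V i = Set.univ) :
    ∃ Φ : Y → UniformFun ι ℝ, Continuous Φ ∧ ∀ x y, Φ x = Φ y → ∃ i, x ∈ V i ∧ y ∈ V i := by
  obtain ⟨ρ, hρ⟩ := PartitionOfUnity.exists_isSubordinate isClosed_univ V hV hcov.ge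
  refine ⟨_, ρ.continuous_uniformFun, fun x y hxy => ?_⟩
  obtain ⟨i, hi⟩ := ρ.exists_pos (Set.mem_univ x)
  have hiy : ρ i x = ρ i y := congrFun (UniformFun.ofFun.injective hxy) i
  exact ⟨i, hρ i (subset_tsupport _ hi.ne'), hρ i (subset_tsupport _ (hiy ▸ hi).ne')⟩

theorem UniformFun.metrizableSpace (ι β : Type*) [MetricSpace β] :
    TopologicalSpace.MetrizableSpace (UniformFun ι β) := by
  obtain ⟨s, hs⟩ := (uniformity β).exists_antitone_basis
  have : IsCountablyGenerated (uniformity (UniformFun ι β)) :=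
    HasCountableBasis.isCountablyGenerated
      ⟨UniformFun.hasBasis_uniformity_of_basis ι β hs.1, Set.to_countable _⟩
  exact UniformSpace.metrizableSpace

/-- A closed Hausdorff image of a metric space has a point-separating sequence of open covers. -/
theorem IsClosedMap.exists_separating_covers {T Y : Type*} [MetricSpace T] [TopologicalSpace Y]
    [T2Space Y] {φ : T → Y} (hφ : Continuous φ) (hcl : IsClosedMap φ)
    (hsurj : Function.Surjective φ) :
    ∃ V : ℕ → Y → Set Y, (∀ n y, IsOpen (V n y)) ∧ (∀ n, ⋃ y, V n y = Set.univ) ∧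
      ∀ x y, (∀ n, ∃ z, x ∈ V n z ∧ y ∈ V n z) → x = y := by
  -- These are the points whose whole `φ`-fiber lies in the `1/(n+1)`-thickening of the fiber of
  -- `y`. If `x` and `y` share the `n`-th set of `z n` for all `n`, then `z` converges to both.
  refine ⟨fun n y => (φ '' (Metric.thickening (1 / ((n : ℝ) + 1)) (φ ⁻¹' {y}))ᶜ)ᶜ,
    fun n y => (hcl _ Metric.isOpen_thickening.isClosed_compl).isOpen_compl, fun n => ?_, ?_⟩
  · refine Set.eq_univ_of_forall fun y => Set.mem_iUnion.2 ⟨y, ?_⟩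
    rintro ⟨t, ht, rfl⟩
    exact ht (Metric.self_subset_thickening Nat.one_div_pos_of_nat _ rfl)
  · intro x y h
    choose z hxz hyz using h
    have key : ∀ t : T, (∀ n : ℕ,
        φ t ∈ (φ '' (Metric.thickening (1 / ((n : ℝ) + 1)) (φ ⁻¹' {z n}))ᶜ)ᶜ) →
        Tendsto z atTop (𝓝 (φ t)) := by
      intro t ht
      have : ∀ n : ℕ, ∃ w, φ w = z n ∧ dist t w < 1 / ((n : ℝ) + 1) := by
        intro n
        by_contra! hno
        refine ht n ⟨t, fun hmem => ?_, rfl⟩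
        obtain ⟨w, hw, htw⟩ := Metric.mem_thickening_iff.1 hmem
        exact (hno w hw).not_gt htw
      choose w hwz htw using this
      have hw : Tendsto w atTop (𝓝 t) := by
        refine tendsto_iff_dist_tendsto_zero.2 (squeeze_zero (fun _ => dist_nonneg)
          (fun n => ?_) tendsto_one_div_add_atTop_nhds_zero_nat)
        rw [dist_comm]
        exact (htw n).le
      exact ((hφ.tendsto t).comp hw).congr hwz
    obtain ⟨p, rfl⟩ := hsurj x
    obtain ⟨q, rfl⟩ := hsurj y
    exact tendsto_nhds_unique (key p hxz) (key q hyz)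

/-- A closed Hausdorff image of a metric space is metrizable if it maps to a metric space in such
a way that sequences with convergent image have cluster points. -/
theorem ClustersAlong.metrizableSpace {T : Type*} {Y Z : Type u} [MetricSpace T]
    [TopologicalSpace Y] [T2Space Y] [MetricSpace Z] {φ : T → Y} (hφ : Continuous φ)
    (hcl : IsClosedMap φ) (hsurj : Function.Surjective φ) {g : Y → Z} (hg : ClustersAlong g)
    (hcont : Continuous g) : TopologicalSpace.MetrizableSpace Y := by
  have := hg.paracompactSpace hcont (hg.isCompact_fiber hφ hcl hsurj hcont)
  obtain ⟨V, hVo, hVcov, hVsep⟩ := hcl.exists_separating_covers hφ hsurj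
  choose Φ hΦ hΦV using fun n => exists_continuous_uniformFun_fiber_subset (V n) (hVo n) (hVcov n)
  have := UniformFun.metrizableSpace Y ℝ
  -- The factor `g` supplies clustering, the factors `Φ n` injectivity.
  let h : Y → Z × (ℕ → UniformFun Y ℝ) := fun y => (g y, fun n => Φ n y)
  have hh : Continuous h := hcont.prodMk (continuous_pi hΦ)
  have hclust : ClustersAlong h := fun u z hz => hg u z.1 ((continuous_fst.tendsto z).comp hz)
  have hinj : Function.Injective h := fun x y hxy =>
    hVsep x y fun n => hΦV n x y (congrFun (congrArg Prod.snd hxy) n)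
  exact (hclust.isEmbedding hh hinj).metrizableSpace

theorem mainTheorem1 {X Y : Type*} [TopologicalSpace X] [TopologicalSpace Y]
    (hX : IsSubmetrizable X) [T2Space Y] (hY : IsMSpace Y)
    (f : X → Y) (hf_cont : Continuous f) (hf_closed : IsClosedMap f)
    (hf_surj : Function.Surjective f) :
    TopologicalSpace.MetrizableSpace Y := by
  obtain ⟨Z, _, g, hgc, hg⟩ := hY.exists_clustersAlong
  obtain ⟨M, _, i, hi, hinj⟩ := hX.exists_injective
  have : T2Space X := T2Space.of_injective_continuous hinj hi
  obtain ⟨T, φ, hφ, hcl, hsurj⟩ := hf_closed.exists_metric_domain hf_cont hf_surj hg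
    (e := fun x => (i x, g (f x))) (hi.prodMk (hgc.comp hf_cont))
    (fun x y hxy => hinj (congrArg Prod.fst hxy)) continuous_snd fun _ => rfl
  exact hg.metrizableSpace hφ hcl hsurj hgc
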